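/- Let $d\ge 1$ be an integer. For $\eta\in\mathbb{R}$ and $\boldsymbol{\alpha}\in\mathbb{R}^d$, let $\mathcal{A}_\eta(\boldsymbol{\alpha})$ denote the set of all accumulation points in $\mathbb{R}^d$ of the set \[\mathrm{NA}_\eta(\boldsymbol{\alpha})=\{|q|^{\eta}(q\boldsymbol{\alpha}-\boldsymbol{p}) : q\in\mathbb{Z}\setminus\{0\},\ \boldsymbol{p}\in\mathbb{Z}^d\},\] where $\boldsymbol{x}$ is an accumulation point of a set $S$ if every neighbourhood of $\boldsymbol{x}$ contains a point of $S$ different from $\boldsymbol{x}$. Let \[\mathcal{D}(\eta)=\{\boldsymbol{\alpha}\in\mathbb{R}^d : \mathcal{A}_\eta(\boldsymbol{\alpha})=\mathbb{R}^d\}.\] Then, for every real number $\eta>1/d$, \[\dim_H(\mathcal{D}(\eta))=\frac{d+1}{1+\eta},\] where $\dim_H$ denotes Hausdorff dimension. -/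

import Mathlib

open Set Filter Topology

/-- The set `NA_η(α) = {|q| ^ η (q α - p) : q ∈ ℤ \ {0}, p ∈ ℤ ^ d}` of `η`-normalized
approximations to `α ∈ ℝ ^ d`. -/
def normalizedApprox {d : ℕ} (η : ℝ) (α : Fin d → ℝ) : Set (Fin d → ℝ) :=
  {x | ∃ (q : ℤ) (p : Fin d → ℤ), q ≠ 0 ∧
    x = (|(q : ℝ)| ^ η) • ((q : ℝ) • α - fun i => (p i : ℝ))}

/-- The set `A_η(α)` of all accumulation points of `NA_η(α)`: the points each of whose punctured
neighbourhoods meets `NA_η(α)`. -/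
def accumulationPoints {d : ℕ} (η : ℝ) (α : Fin d → ℝ) : Set (Fin d → ℝ) :=
  derivedSet (normalizedApprox η α)

/-- The set `D(η)` of all `α ∈ ℝ ^ d` for which every point of `ℝ ^ d` is an accumulation point
of the `η`-normalized approximations to `α`. -/
def denseSet (d : ℕ) (η : ℝ) : Set (Fin d → ℝ) :=
  {α | accumulationPoints η α = Set.univ}

/-! Upper bound. If `α` lies in `D(η)`, then `0` is an accumulation point, so `α` lies within `q ^
(-(1 + η))` of `p / q` for infinitely many pairs `(q, p)`. In a bounded region there are `O(q ^ d)`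
numerators per `q`, and `∑ q ^ (d - (1 + η) s)` converges once `(1 + η) s > d + 1`; Borel-Cantelli
for Hausdorff measure finishes.

Lower bound. Let `(1 + η) s < d + 1`. If `D(η)` were null for `μH[s]`, sets `U n` of sizes `ρ n`
with `∑ ρ n ^ s ≤ κ` would cover it. Nested balls are built so that the sets meeting a ball of
radius `r` have total weight `∑ ρ n ^ s ≤ κ r ^ s`, and each new ball forces a normalized
approximation close to a prescribed target. With all targets and errors treated, the common point
`z` is in `D(η)`; but a set `U n` containing `z` meets every ball, so `ρ n ^ s ≤ κ r ^ s` with `r →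
0`, a contradiction.

The inductive step rests on two facts. By Dirichlet and a count of exceptions
(`exists_grid_near_rational`), half the points of a grid of mesh `4 δ`, `δ ≍ M ^ (-(d + 1))`, are
within `δ` of some `p / q` with `q ≍ M ^ d`. Shifting `p / q` by `q ^ (-(1 + η)) y` gives a centre
near which `p / q` yields approximations close to `y`; as `η > 1 / d`, this shift is negligible
against `δ`. By averaging (`exists_meetSum_le`), one of these balls inherits the weight bound, since
they number about `(R / δ) ^ d`, far more than `(R / r) ^ s`. -/

open MeasureTheory Measure
open scoped ENNReal NNReal

/-! ### Upper bound: Borel-Cantelli for Hausdorff measure -/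

/-- The Hausdorff version of the (first) Borel-Cantelli lemma: if `∑ diam (f i) ^ s` converges, then
the points lying in infinitely many of the sets `f i` form a set of `s`-dimensional Hausdorff
measure zero. -/
theorem hausdorffMeasure_eq_zero_of_infinite {X ι : Type*} [EMetricSpace X] [MeasurableSpace X]
    [BorelSpace X] [Countable ι] {s : ℝ} (hs : 0 < s) (f : ι → Set X)
    (hf : ∑' i, Metric.ediam (f i) ^ s ≠ ∞) {E : Set X}
    (hE : ∀ x ∈ E, {i | x ∈ f i}.Infinite) : μH[s] E = 0 := by
  set tail : Finset ι → ℝ≥0∞ := fun F => ∑' i : {i // i ∉ F}, Metric.ediam (f i) ^ s with htail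
  have ht : Tendsto tail atTop (𝓝 0) := ENNReal.tendsto_tsum_compl_atTop_zero hf
  -- The covers are indexed by finite sets `F`, omitting the members in `F`. One member is bounded
  -- by the whole tail, so `tail F ^ s⁻¹` bounds all diameters and tends to `0`.
  have key := hausdorffMeasure_le_liminf_tsum (ι := fun F : Finset ι => {i // i ∉ F}) s E
    (l := atTop) (fun F => tail F ^ s⁻¹) ?_ (fun F i => f i) ?_ ?_
  · rw [Tendsto.liminf_eq ht] at key
    exact le_antisymm key bot_le
  · have := ((ENNReal.continuous_rpow_const (y := s⁻¹)).tendsto 0).comp ht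
    simpa [ENNReal.zero_rpow_of_pos (inv_pos.2 hs), Function.comp_def] using this
  · refine Eventually.of_forall fun F i => ?_
    rw [ENNReal.le_rpow_inv_iff hs]
    exact ENNReal.le_tsum (f := fun i : {i // i ∉ F} => Metric.ediam (f i) ^ s) i
  · refine Eventually.of_forall fun F x hx => ?_
    obtain ⟨i, hi, hiF⟩ := (hE x hx).exists_notMem_finset F
    exact mem_iUnion.2 ⟨⟨i, hiF⟩, hi⟩

/-- A vector close to which lie infinitely many normalized approximations has infinitely many
good rational approximations with natural denominators. -/
theorem infinite_setOf_norm_normalizedApprox_le {d : ℕ} {η : ℝ} {α : Fin d → ℝ}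
    (h : (0 : Fin d → ℝ) ∈ accumulationPoints η α) :
    {z : ℕ × (Fin d → ℤ) | z.1 ≠ 0 ∧
      ‖((z.1 : ℝ) ^ η) • ((z.1 : ℝ) • α - fun i => (z.2 i : ℝ))‖ ≤ 1}.Infinite := by
  set T := {z : ℕ × (Fin d → ℤ) | z.1 ≠ 0 ∧
      ‖((z.1 : ℝ) ^ η) • ((z.1 : ℝ) • α - fun i => (z.2 i : ℝ))‖ ≤ 1} with hT
  set g : ℕ × (Fin d → ℤ) → Fin d → ℝ :=
    fun z => ((z.1 : ℝ) ^ η) • ((z.1 : ℝ) • α - fun i => (z.2 i : ℝ)) with hg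
  intro hfin
  have h0 : AccPt (0 : Fin d → ℝ) (𝓟 (normalizedApprox η α)) := h
  have hinf := Set.Infinite.of_accPt (h0.nhds_inter (Metric.ball_mem_nhds 0 one_pos))
  -- Replacing `(q, p)` by `(-q, -p)` only changes the sign of the approximation, so natural
  -- denominators suffice up to sign.
  refine hinf (((hfin.image g).union (hfin.image fun z => -g z)).subset ?_)
  rintro x ⟨hx1, q, p, hq, rfl⟩
  rw [mem_ball_zero_iff] at hx1
  rcases le_or_gt 0 q with h | h
  · left
    lift q to ℕ using h
    refine ⟨(q, p), ⟨by simpa using hq, ?_⟩, ?_⟩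
    · simpa using hx1.le
    · simp [hg]
  · right
    obtain ⟨n, rfl⟩ : ∃ n : ℕ, q = -(n : ℤ) := ⟨q.natAbs, by omega⟩
    have e : -g (n, -p) = (|((-(n : ℤ) : ℤ) : ℝ)| ^ η) •
        (((-(n : ℤ) : ℤ) : ℝ) • α - fun i => (p i : ℝ)) := by
      ext i
      simp [hg]
      ring
    refine ⟨(n, -p), ⟨by simpa using hq, ?_⟩, e⟩
    rw [← e, norm_neg] at hx1
    exact hx1.le

/-- The part of `D(η)` in a ball is null for the `s`-dimensional Hausdorff measure when
`s > (d + 1) / (1 + η)`. -/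
theorem hausdorffMeasure_denseSet_inter_eq_zero {d : ℕ} {η s : ℝ} (hη : 0 < η)
    (hs : (d : ℝ) + 1 < (1 + η) * s) (N : ℕ) :
    μH[s] (denseSet d η ∩ Metric.closedBall 0 N) = 0 := by
  classical
  have hs0 : 0 < s := by
    by_contra hcon
    have : (1 + η) * s ≤ 0 := mul_nonpos_of_nonneg_of_nonpos (by linarith) (by linarith)
    have : (0 : ℝ) ≤ d := d.cast_nonneg
    linarith
  -- For `‖α‖ ≤ N` and `‖n α - p‖ ≤ 1`, each `|p i|` is at most `n N + 1 ≤ (N + 1) n`.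
  set C : ℕ := N + 1 with hC
  set box : ℕ → Finset (Fin d → ℤ) := fun n =>
    Fintype.piFinset fun _ => Finset.Icc (-((C * n : ℕ) : ℤ)) ((C * n : ℕ) : ℤ) with hbox
  set f : ℕ × (Fin d → ℤ) → Set (Fin d → ℝ) := fun z =>
    if z.1 ≠ 0 ∧ z.2 ∈ box z.1 then
      Metric.closedBall ((z.1 : ℝ)⁻¹ • fun i => (z.2 i : ℝ)) ((z.1 : ℝ) ^ (-(1 + η))) else ∅ with hf
  refine hausdorffMeasure_eq_zero_of_infinite hs0 f ?_ ?_
  · have hle : ∀ n : ℕ, ∑' p, Metric.ediam (f (n, p)) ^ s ≤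
        ENNReal.ofReal ((3 * C) ^ d * 2 ^ s * (n : ℝ) ^ ((d : ℝ) - (1 + η) * s)) := by
      intro n
      rcases eq_or_ne n 0 with rfl | hn
      · simp [hf, ENNReal.zero_rpow_of_pos hs0]
      have hn1 : (1 : ℝ) ≤ n := by exact_mod_cast Nat.one_le_iff_ne_zero.2 hn
      rw [tsum_eq_sum (s := box n)]
      · have hcard : ((box n).card : ℝ) ≤ (3 * C * n) ^ d := by
          have : (box n).card = (2 * (C * n) + 1) ^ d := by
            simp only [hbox, Fintype.card_piFinset, Int.card_Icc, Finset.prod_const,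
              Finset.card_univ, Fintype.card_fin]
            congr 1
            omega
          rw [this]
          push_cast
          gcongr
          have : (1 : ℝ) ≤ C := by simp [hC]
          nlinarith
        calc ∑ p ∈ box n, Metric.ediam (f (n, p)) ^ s
            ≤ ∑ p ∈ box n, ENNReal.ofReal (2 * (n : ℝ) ^ (-(1 + η))) ^ s := by
              refine Finset.sum_le_sum fun p hp => ?_
              gcongr
              simp only [hf, hn, hp, ne_eq, not_false_eq_true, and_self, if_true]
              refine Metric.ediam_le fun x hx y hy => ?_
              rw [edist_dist, two_mul]
              exact ENNReal.ofReal_le_ofReal ((dist_triangle_right x y _).trans (add_le_add hx hy))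
          _ = ENNReal.ofReal ((box n).card * (2 * (n : ℝ) ^ (-(1 + η))) ^ s) := by
              rw [Finset.sum_const, nsmul_eq_mul, ENNReal.ofReal_rpow_of_nonneg (by positivity) hs0.le,
                ENNReal.ofReal_mul (by positivity), ENNReal.ofReal_natCast]
          _ ≤ _ := by
              apply ENNReal.ofReal_le_ofReal
              calc _ ≤ (3 * C * n) ^ d * (2 * (n : ℝ) ^ (-(1 + η))) ^ s := by gcongr
                _ = _ := by
                  rw [Real.mul_rpow (by norm_num) (by positivity), mul_pow,
                    ← Real.rpow_mul (by positivity), sub_eq_add_neg, Real.rpow_add (by positivity),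
                    Real.rpow_natCast]
                  ring_nf
      · intro p hp
        simp [hf, hp, ENNReal.zero_rpow_of_pos hs0]
    rw [ENNReal.tsum_prod (f := fun n p => Metric.ediam (f (n, p)) ^ s)]
    refine ne_top_of_le_ne_top ?_ (ENNReal.tsum_le_tsum hle)
    refine Summable.tsum_ofReal_ne_top ?_
    exact (Real.summable_nat_rpow.2 (by linarith)).mul_left _
  · rintro α ⟨hα, hαN⟩
    have h0 : (0 : Fin d → ℝ) ∈ accumulationPoints η α := by
      rw [show accumulationPoints η α = univ from hα]; trivial
    refine (infinite_setOf_norm_normalizedApprox_le h0).mono ?_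
    rintro ⟨n, p⟩ ⟨hn, hp⟩
    simp only at hn hp
    have hn1 : (1 : ℝ) ≤ n := by exact_mod_cast Nat.one_le_iff_ne_zero.2 hn
    have hn0 : (0 : ℝ) < n := by linarith
    have hpow : (0 : ℝ) < (n : ℝ) ^ η := by positivity
    rw [norm_smul, Real.norm_of_nonneg hpow.le] at hp
    have hle : ‖(n : ℝ) • α - fun i => (p i : ℝ)‖ ≤ 1 := by
      have : 1 ≤ (n : ℝ) ^ η := Real.one_le_rpow hn1 hη.le
      nlinarith [norm_nonneg ((n : ℝ) • α - fun i => (p i : ℝ))]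
    have hmem : p ∈ box n := by
      rw [hbox, Fintype.mem_piFinset]
      intro i
      rw [mem_closedBall_zero_iff] at hαN
      have h1 := (norm_le_pi_norm _ i).trans hle
      have h2 := (norm_le_pi_norm _ i).trans hαN
      simp only [Pi.sub_apply, Pi.smul_apply, smul_eq_mul, Real.norm_eq_abs] at h1 h2
      rw [abs_le] at h1 h2
      have h3 : (n : ℝ) * α i ≤ n * N := by gcongr; exact h2.2
      have h4 : (n : ℝ) * (-N) ≤ n * α i := by gcongr; exact h2.1
      rw [Finset.mem_Icc]
      constructor
      · have : (-((C * n : ℕ) : ℝ)) ≤ p i := by push_cast [hC]; nlinarith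
        exact_mod_cast this
      · have : (p i : ℝ) ≤ ((C * n : ℕ) : ℝ) := by push_cast [hC]; nlinarith
        exact_mod_cast this
    have : α ∈ f (n, p) := by
      simp only [hf, hn, hmem, ne_eq, not_false_eq_true, and_self, if_true]
      rw [mem_closedBall_iff_norm]
      have e : α - (n : ℝ)⁻¹ • (fun i => (p i : ℝ)) =
          (n : ℝ)⁻¹ • ((n : ℝ) • α - fun i => (p i : ℝ)) := by
        rw [smul_sub, smul_smul, inv_mul_cancel₀ hn0.ne', one_smul]
      rw [e, norm_smul, norm_inv, Real.norm_of_nonneg hn0.le, neg_add, Real.rpow_add hn0,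
        Real.rpow_neg_one, Real.rpow_neg hn0.le]
      gcongr
      rwa [← one_div, le_div_iff₀' hpow]
    exact this

theorem dimH_denseSet_le {d : ℕ} {η : ℝ} (hη : 0 < η) :
    dimH (denseSet d η) ≤ ENNReal.ofReal (((d : ℝ) + 1) / (1 + η)) := by
  have hU : denseSet d η = ⋃ N : ℕ, denseSet d η ∩ Metric.closedBall 0 N := by
    rw [← inter_iUnion, Metric.iUnion_closedBall_nat, inter_univ]
  rw [hU, dimH_iUnion]
  refine iSup_le fun N => ?_
  refine le_of_forall_gt fun b hb => ?_
  obtain ⟨c, hc1, hc2⟩ := ENNReal.lt_iff_exists_nnreal_btwn.1 hb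
  refine lt_of_le_of_lt (dimH_le_of_hausdorffMeasure_ne_top ?_) hc2
  rw [hausdorffMeasure_denseSet_inter_eq_zero hη _ N]
  · simp
  · have := (ENNReal.ofReal_lt_iff_lt_toReal (by positivity) ENNReal.coe_ne_top).1 hc1
    rw [ENNReal.coe_toReal, div_lt_iff₀ (by linarith)] at this
    linarith

/-! ### Dirichlet's theorem and grid points near rationals -/

/-- Dirichlet's theorem on simultaneous approximation. -/
theorem exists_simultaneous_approx {d M : ℕ} (hM : 0 < M) (α : Fin d → ℝ) :
    ∃ q : ℕ, 0 < q ∧ q ≤ M ^ d ∧ ∃ p : Fin d → ℤ, ∀ i, |q * α i - p i| ≤ 1 / M := by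
  have hM' : (0 : ℝ) < M := by exact_mod_cast hM
  have hlt : ∀ (n : ℕ) (i : Fin d), ⌊Int.fract (n * α i) * M⌋₊ < M := fun n i => by
    rw [Nat.floor_lt (by positivity)]
    nlinarith [Int.fract_lt_one (n * α i)]
  -- Pigeonhole: the fractional parts of `M ^ d + 1` multiples of `α` fall into `M ^ d` cubes of
  -- side `1 / M`.
  let f : Fin (M ^ d + 1) → Fin d → Fin M := fun n i => ⟨_, hlt n i⟩
  obtain ⟨a, b, hab, hf⟩ := Fintype.exists_ne_map_eq_of_card_lt f (by simp)
  wlog h : a < b generalizing a b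
  · exact this b a hab.symm hf.symm (lt_of_le_of_ne (not_lt.1 h) hab.symm)
  have hab' : (a : ℕ) < b := h
  refine ⟨b - a, by omega, by omega, fun i => ⌊(b : ℝ) * α i⌋ - ⌊(a : ℝ) * α i⌋, fun i => ?_⟩
  have hi : ⌊Int.fract ((a : ℕ) * α i) * M⌋₊ = ⌊Int.fract ((b : ℕ) * α i) * M⌋₊ :=
    congrArg Fin.val (congrFun hf i)
  have e : ((b - a : ℕ) : ℝ) * α i - ((⌊(b : ℝ) * α i⌋ - ⌊(a : ℝ) * α i⌋ : ℤ) : ℝ) =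
      Int.fract ((b : ℕ) * α i) - Int.fract ((a : ℕ) * α i) := by
    rw [Nat.cast_sub hab'.le, Int.fract, Int.fract]
    push_cast
    ring
  have h1 := Nat.floor_le (a := Int.fract ((a : ℕ) * α i) * M) (by positivity)
  have h2 := Nat.lt_floor_add_one (Int.fract ((a : ℕ) * α i) * M)
  have h3 := Nat.floor_le (a := Int.fract ((b : ℕ) * α i) * M) (by positivity)
  have h4 := Nat.lt_floor_add_one (Int.fract ((b : ℕ) * α i) * M)
  rw [hi] at h1 h2
  rw [e, le_div_iff₀ hM', ← abs_of_pos hM', ← abs_mul, abs_le]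
  constructor <;> nlinarith

/-- The condition `u ≤ v + 1` keeps the bound nonnegative, which is what an empty interval needs. -/
theorem card_int_le_of_forall_mem_Icc {S : Finset ℤ} {u v : ℝ} (huv : u ≤ v + 1)
    (h : ∀ n ∈ S, (n : ℝ) ∈ Icc u v) : (S.card : ℝ) ≤ v - u + 1 := by
  have hS : S ⊆ Finset.Icc ⌈u⌉ ⌊v⌋ := fun n hn =>
    Finset.mem_Icc.2 ⟨Int.ceil_le.2 (h n hn).1, Int.le_floor.2 (h n hn).2⟩
  have hc : (S.card : ℝ) ≤ ((⌊v⌋ + 1 - ⌈u⌉).toNat : ℝ) := by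
    exact_mod_cast (Finset.card_le_card hS).trans (Int.card_Icc _ _).le
  refine hc.trans ?_
  rcases le_total 0 (⌊v⌋ + 1 - ⌈u⌉) with h0 | h0
  · have : ((⌊v⌋ + 1 - ⌈u⌉).toNat : ℝ) = ⌊v⌋ + 1 - ⌈u⌉ := by
      exact_mod_cast congrArg (Int.cast : ℤ → ℝ) (Int.toNat_of_nonneg h0)
    rw [this]
    linarith [Int.floor_le v, Int.le_ceil u]
  · rw [Int.toNat_of_nonpos h0]
    push_cast
    linarith

theorem card_nat_le_of_forall_mem_Icc {S : Finset ℕ} {u v : ℝ} (huv : u ≤ v + 1)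
    (h : ∀ n ∈ S, (n : ℝ) ∈ Icc u v) : (S.card : ℝ) ≤ v - u + 1 := by
  have := card_int_le_of_forall_mem_Icc (S := S.map Nat.castEmbedding) huv (by simpa using h)
  simpa using this

open Classical in
/-- The number of terms of an arithmetic progression lying close to an integer. -/
theorem card_filter_near_int_le (a : ℝ) {b h : ℝ} (hb : 0 < b) (hh : 0 ≤ h) (K : ℕ) :
    (((Finset.range K).filter fun n : ℕ => ∃ p : ℤ, |a + b * n - p| ≤ h).card : ℝ) ≤
      (b * K + 2 * h + 1) * (2 * h / b + 1) := by
  -- `P` holds every integer that the progression can approach; for each one, the admissible `n`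
  -- fill an interval of length `2 h / b`.
  set P := Finset.Icc ⌈a - h⌉ ⌊a + b * K + h⌋ with hP
  have hsub : ((Finset.range K).filter fun n : ℕ => ∃ p : ℤ, |a + b * n - p| ≤ h) ⊆
      P.biUnion fun p => (Finset.range K).filter fun n : ℕ => |a + b * n - p| ≤ h := by
    intro n hn
    obtain ⟨hn, p, hp⟩ := Finset.mem_filter.1 hn
    refine Finset.mem_biUnion.2 ⟨p, Finset.mem_Icc.2 ⟨?_, ?_⟩, Finset.mem_filter.2 ⟨hn, hp⟩⟩
    · rw [Int.ceil_le]
      have : 0 ≤ b * n := by positivity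
      linarith [(abs_le.1 hp).2]
    · rw [Int.le_floor]
      have : b * n ≤ b * K := by
        gcongr
        exact (Finset.mem_range.1 hn).le
      linarith [(abs_le.1 hp).1]
  have hcP : (P.card : ℝ) ≤ b * K + 2 * h + 1 := by
    have hbK : 0 ≤ b * K := by positivity
    refine (card_int_le_of_forall_mem_Icc (u := a - h) (v := a + b * K + h) (by linarith)
      fun n hn => ?_).trans_eq (by ring)
    rw [hP, Finset.mem_Icc, Int.ceil_le, Int.le_floor] at hn
    exact hn
  calc _ ≤ ((P.biUnion fun p => (Finset.range K).filter fun n : ℕ =>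
        |a + b * n - p| ≤ h).card : ℝ) := by exact_mod_cast Finset.card_le_card hsub
    _ ≤ ∑ p ∈ P, (((Finset.range K).filter fun n : ℕ => |a + b * n - p| ≤ h).card : ℝ) := by
        exact_mod_cast Finset.card_biUnion_le
    _ ≤ ∑ p ∈ P, (2 * h / b + 1) := by
        refine Finset.sum_le_sum fun p _ => ?_
        refine (card_nat_le_of_forall_mem_Icc (u := (p - a - h) / b) (v := (p - a + h) / b) ?_
          fun n hn => ?_).trans_eq (by ring)
        · have : (p - a - h) / b ≤ (p - a + h) / b := by gcongr; linarith
          linarith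
        · have := abs_le.1 (Finset.mem_filter.1 hn).2
          rw [mem_Icc, div_le_iff₀ hb, le_div_iff₀ hb]
          constructor <;> linarith
    _ = P.card * (2 * h / b + 1) := by rw [Finset.sum_const, nsmul_eq_mul]
    _ ≤ _ := by gcongr

open Classical in
/-- The number of grid points whose multiple by `q` lies close to an integer point. -/
theorem card_filter_grid_near_int_le {d : ℕ} (x : Fin d → ℝ) {b h : ℝ} {q : ℕ} (hq : 0 < q)
    (hb : 0 < b) (hh : 0 ≤ h) (K : ℕ) :
    (((Fintype.piFinset fun _ : Fin d => Finset.range K).filter fun j =>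
      ∃ p : Fin d → ℤ, ∀ i, |q * (x i + b * j i) - p i| ≤ h).card : ℝ) ≤
      ((q * b * K + 2 * h + 1) * (2 * h / (q * b) + 1)) ^ d := by
  have hsub : ((Fintype.piFinset fun _ : Fin d => Finset.range K).filter fun j =>
      ∃ p : Fin d → ℤ, ∀ i, |q * (x i + b * j i) - p i| ≤ h) ⊆
      Fintype.piFinset fun i => (Finset.range K).filter fun n : ℕ =>
        ∃ p : ℤ, |q * x i + q * b * n - p| ≤ h := by
    intro j hj
    obtain ⟨hj, p, hp⟩ := Finset.mem_filter.1 hj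
    refine Fintype.mem_piFinset.2 fun i =>
      Finset.mem_filter.2 ⟨Fintype.mem_piFinset.1 hj i, p i, ?_⟩
    convert hp i using 3
    ring
  calc _ ≤ ((Fintype.piFinset fun i => (Finset.range K).filter fun n : ℕ =>
        ∃ p : ℤ, |q * x i + q * b * n - p| ≤ h).card : ℝ) := by
        exact_mod_cast Finset.card_le_card hsub
    _ = ∏ i, (((Finset.range K).filter fun n : ℕ =>
        ∃ p : ℤ, |q * x i + q * b * n - p| ≤ h).card : ℝ) := by
        rw [Fintype.card_piFinset]
        push_cast
        rfl
    _ ≤ ∏ _i : Fin d, ((q * b * K + 2 * h + 1) * (2 * h / (q * b) + 1)) :=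
        Finset.prod_le_prod (fun _ _ => by positivity) fun i _ =>
          card_filter_near_int_le _ (by positivity) hh K
    _ = _ := by simp

/-- At least half of the points of a suitable grid in a given ball are close to rational points
with denominators of the maximal order of magnitude. -/
theorem exists_grid_near_rational {d : ℕ} (hd : 1 ≤ d) :
    ∃ A : ℕ, 0 < A ∧ ∀ (x : Fin d → ℝ) {R : ℝ}, 0 < R → ∀ᶠ M : ℕ in atTop, ∀ δ : ℝ,
      δ = A / (M : ℝ) ^ (d + 1) → ∃ (K : ℕ) (G : Finset (Fin d → ℕ)),
        R ≤ 16 * δ * K ∧ 8 * δ * K ≤ R ∧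
        (G ⊆ Fintype.piFinset fun _ => Finset.range K) ∧ (K : ℝ) ^ d / 2 ≤ G.card ∧
        ∀ j ∈ G, ∃ (q : ℕ) (p : Fin d → ℤ), 0 < q ∧ (M : ℝ) ^ d ≤ A * q ∧ q ≤ M ^ d ∧
          ∀ i, |q * (x i + 4 * δ * j i) - p i| ≤ 1 / M := by
  classical
  -- With this `A`, the sum of `24 ^ d K ^ d / M ^ d` over `q ≤ M ^ d / A` is at most `K ^ d / 4`.
  set A : ℕ := 4 * 24 ^ d with hA
  have hA0 : 0 < A := by positivity
  have hA0' : (0 : ℝ) < A := by exact_mod_cast hA0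
  refine ⟨A, hA0, fun x R hR => ?_⟩
  -- For `q ≥ q₀` the boundary term `6 / (q R)` is at most `1`. The boundedly many smaller `q` obey
  -- the cruder bound with `X` and become negligible as `M` grows.
  set q₀ : ℕ := ⌈6 / R⌉₊ with hq₀
  set X : ℝ := (12 * (1 + 6 / R)) ^ d with hX
  have hX0 : 0 ≤ X := by positivity
  have ev1 : ∀ᶠ M : ℕ in atTop, max (4 * q₀ * X) (8 * A / R) ≤ M :=
    tendsto_natCast_atTop_atTop.eventually_ge_atTop _
  filter_upwards [ev1, eventually_ge_atTop 1] with M hM hM1 δ hδ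
  have hM0 : (0 : ℝ) < M := by exact_mod_cast hM1
  have hM1' : (1 : ℝ) ≤ M := by exact_mod_cast hM1
  have hMd : (M : ℝ) ≤ (M : ℝ) ^ d := le_self_pow₀ hM1' (by omega)
  have hMd1 : (M : ℝ) ≤ (M : ℝ) ^ (d + 1) := le_self_pow₀ hM1' (by omega)
  have hδ0 : 0 < δ := by rw [hδ]; positivity
  set K : ℕ := ⌊R / (8 * δ)⌋₊ with hK
  have hKle : 8 * δ * K ≤ R := by
    have := Nat.floor_le (a := R / (8 * δ)) (by positivity)
    rwa [le_div_iff₀ (by positivity), mul_comm] at this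
  have hK1 : (1 : ℝ) ≤ K := by
    have : 1 ≤ K := by
      rw [hK, Nat.one_le_floor_iff, le_div_iff₀ (by positivity), hδ, one_mul, ← mul_div_assoc,
        div_le_iff₀ (by positivity)]
      have h1 := (le_max_right _ _).trans hM
      rw [div_le_iff₀ hR] at h1
      nlinarith
    exact_mod_cast this
  have hKge : R ≤ 16 * δ * K := by
    have := Nat.lt_floor_add_one (R / (8 * δ))
    rw [← hK, div_lt_iff₀ (by positivity)] at this
    nlinarith
  set J : Finset (Fin d → ℕ) := Fintype.piFinset fun _ => Finset.range K with hJ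
  have hJc : (J.card : ℝ) = (K : ℝ) ^ d := by simp [hJ]
  set near : ℕ → (Fin d → ℕ) → Prop := fun q j =>
    ∃ p : Fin d → ℤ, ∀ i, |q * (x i + 4 * δ * j i) - p i| ≤ 1 / (M : ℝ) with hnear
  -- A grid point is bad if a denominator at most `M ^ d / A` already approximates it to within `1 /
  -- M`; elsewhere the Dirichlet denominator must be large.
  set bad : Finset (Fin d → ℕ) := (Finset.Icc 1 (M ^ d / A)).biUnion fun q => J.filter (near q)
    with hbad
  have hcount : ∀ q ∈ Finset.Icc 1 (M ^ d / A), ((J.filter (near q)).card : ℝ) ≤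
      (if q < q₀ then (K : ℝ) ^ d * X / (M : ℝ) ^ d else 0) +
        (K : ℝ) ^ d * 24 ^ d / (M : ℝ) ^ d := by
    intro q hq
    obtain ⟨hq1, hq2⟩ := Finset.mem_Icc.1 hq
    have hq0 : (0 : ℝ) < q := by exact_mod_cast hq1
    have hq1' : (1 : ℝ) ≤ q := by exact_mod_cast hq1
    have hqA : (q : ℝ) * A ≤ (M : ℝ) ^ d := by
      exact_mod_cast (Nat.le_div_iff_mul_le hA0).1 hq2
    have h1 := card_filter_grid_near_int_le x (q := q) (b := 4 * δ) (h := 1 / M) hq1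
      (by positivity) (by positivity) K
    have hbase : (q * (4 * δ) * K + 2 * (1 / (M : ℝ)) + 1) * (2 * (1 / M) / (q * (4 * δ)) + 1) ≤
        12 * (1 + 6 / (q * R)) * (K / M) := by
      have e1 : q * (4 * δ) * K + 2 * (1 / (M : ℝ)) + 1 ≤ q * R / 2 + 3 := by
        have : 1 / (M : ℝ) ≤ 1 := by rw [div_le_one hM0]; exact hM1'
        nlinarith
      have e2 : 2 * (1 / (M : ℝ)) / (q * (4 * δ)) + 1 ≤ 3 / 2 * ((M : ℝ) ^ d / (A * q)) := by
        have : 2 * (1 / (M : ℝ)) / (q * (4 * δ)) = 1 / 2 * ((M : ℝ) ^ d / (A * q)) := by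
          rw [hδ]
          field_simp
          ring
        rw [this]
        have : 1 ≤ (M : ℝ) ^ d / (A * q) := by
          rw [le_div_iff₀ (by positivity)]
          linarith
        linarith
      have e3 : R * (M : ℝ) ^ d / A ≤ 16 * (K / M) := by
        rw [div_le_iff₀ hA0']
        have : 16 * (K / (M : ℝ)) * A = 16 * δ * K * (M : ℝ) ^ d := by
          rw [hδ]
          field_simp
          ring
        rw [this]
        gcongr
      calc _ ≤ (q * R / 2 + 3) * (3 / 2 * ((M : ℝ) ^ d / (A * q))) := by gcongr
        _ = 3 / 4 * (1 + 6 / (q * R)) * (R * (M : ℝ) ^ d / A) := by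
          field_simp
          ring
        _ ≤ 3 / 4 * (1 + 6 / (q * R)) * (16 * (K / M)) := by gcongr
        _ = _ := by ring
    have h2 : ((J.filter (near q)).card : ℝ) ≤ (12 * (1 + 6 / (q * R)) * (K / M)) ^ d :=
      h1.trans (by gcongr)
    rw [mul_pow, div_pow] at h2
    refine h2.trans ?_
    split_ifs with hqq
    · have : (12 * (1 + 6 / (q * R))) ^ d ≤ X := by
        rw [hX]
        gcongr
        nlinarith
      calc _ ≤ X * ((K : ℝ) ^ d / (M : ℝ) ^ d) := by gcongr
        _ = (K : ℝ) ^ d * X / (M : ℝ) ^ d := by ring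
        _ ≤ _ := le_add_of_nonneg_right (by positivity)
    · have hqR : 6 / (q * R) ≤ 1 := by
        rw [div_le_one (by positivity)]
        have : 6 / R ≤ q := Nat.ceil_le.1 (not_lt.1 hqq)
        rwa [div_le_iff₀ hR] at this
      calc _ ≤ (24 : ℝ) ^ d * ((K : ℝ) ^ d / (M : ℝ) ^ d) := by
            gcongr
            linarith
        _ = _ := by ring
  have hbadc : (bad.card : ℝ) ≤ (K : ℝ) ^ d / 2 := by
    have hdiv : ((M ^ d / A : ℕ) : ℝ) ≤ (M : ℝ) ^ d / A := by
      exact_mod_cast (Nat.cast_div_le (α := ℝ) (m := M ^ d) (n := A))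
    calc (bad.card : ℝ) ≤ ∑ q ∈ Finset.Icc 1 (M ^ d / A), ((J.filter (near q)).card : ℝ) := by
          exact_mod_cast Finset.card_biUnion_le
      _ ≤ _ := Finset.sum_le_sum hcount
      _ ≤ q₀ * ((K : ℝ) ^ d * X / (M : ℝ) ^ d) +
          ((M : ℝ) ^ d / A) * ((K : ℝ) ^ d * 24 ^ d / (M : ℝ) ^ d) := by
          rw [Finset.sum_add_distrib]
          gcongr
          · rw [← Finset.sum_filter, Finset.sum_const, nsmul_eq_mul]
            gcongr
            calc _ ≤ (Finset.range q₀).card := Finset.card_le_card fun q hq =>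
                  Finset.mem_range.2 (Finset.mem_filter.1 hq).2
              _ = q₀ := Finset.card_range _
          · rw [Finset.sum_const, nsmul_eq_mul, Nat.card_Icc, Nat.add_sub_cancel]
            gcongr
      _ ≤ (K : ℝ) ^ d / 4 + (K : ℝ) ^ d / 4 := by
          gcongr
          · have h1 := (le_max_left _ _).trans hM
            rw [← mul_div_assoc, div_le_iff₀ (by positivity)]
            have : 4 * q₀ * X ≤ (M : ℝ) ^ d := h1.trans hMd
            have hKd : 0 ≤ (K : ℝ) ^ d := by positivity
            nlinarith
          · rw [hA]
            push_cast
            field_simp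
            rfl
      _ = _ := by ring
  refine ⟨K, J \ bad, hKge, hKle, Finset.sdiff_subset, ?_, ?_⟩
  · have := Finset.le_card_sdiff bad J
    have h2 : (J.card : ℝ) - bad.card ≤ (J \ bad).card := by
      rw [_root_.sub_le_iff_le_add]
      exact_mod_cast (by omega : J.card ≤ (J \ bad).card + bad.card)
    linarith
  · intro j hj
    obtain ⟨hjJ, hjb⟩ := Finset.mem_sdiff.1 hj
    obtain ⟨q, hq0, hqM, p, hp⟩ := exists_simultaneous_approx hM1 fun i => x i + 4 * δ * j i
    refine ⟨q, p, hq0, ?_, hqM, hp⟩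
    by_contra hcon
    refine hjb (Finset.mem_biUnion.2 ⟨q, Finset.mem_Icc.2 ⟨hq0, ?_⟩,
      Finset.mem_filter.2 ⟨hjJ, p, hp⟩⟩)
    rw [Nat.le_div_iff_mul_le hA0, mul_comm]
    exact_mod_cast (not_le.1 hcon).le

/-! ### Averaging the weight of a family of sets over separated balls -/

open Classical in
/-- The total `s`-weight `∑ ρ i ^ s` of those members of a family of sets `U i` of sizes `ρ i`
which meet a closed ball. -/
noncomputable def meetSum {X ι : Type*} [PseudoMetricSpace X] (U : ι → Set X) (ρ : ι → ℝ) (s : ℝ)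
    (x : X) (r : ℝ) : ℝ≥0∞ :=
  ∑' i, if (U i ∩ Metric.closedBall x r).Nonempty then ENNReal.ofReal (ρ i ^ s) else 0

theorem ofReal_rpow_le_meetSum {X ι : Type*} [PseudoMetricSpace X] {U : ι → Set X} {ρ : ι → ℝ}
    {s : ℝ} {x : X} {r : ℝ} {i : ι} (h : (U i ∩ Metric.closedBall x r).Nonempty) :
    ENNReal.ofReal (ρ i ^ s) ≤ meetSum U ρ s x r := by
  classical
  refine le_trans ?_ (ENNReal.le_tsum i)
  rw [if_pos h]

/-- The number of perturbed grid points near a set of given size. -/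
theorem card_filter_grid_meet_le {d : ℕ} {x : Fin d → ℝ} {δ r ρ : ℝ} (hδ : 0 < δ)
    {c : (Fin d → ℕ) → Fin d → ℝ} {V : Set (Fin d → ℝ)} (hV : ∀ y ∈ V, ∀ z ∈ V, dist y z ≤ ρ)
    {G : Finset (Fin d → ℕ)}
    (hG : ∀ j ∈ G, dist (c j) (x + (4 * δ) • fun i => (j i : ℝ)) + r ≤ 3 / 2 * δ ∧
      (V ∩ Metric.closedBall (c j) r).Nonempty) :
    (ρ < δ → G.card ≤ 1) ∧ (δ ≤ ρ → (G.card : ℝ) ≤ (3 * ρ / δ) ^ d) := by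
  -- Each ball lies within `3 / 2 * δ` of its grid point, so two balls met by `V` have grid points
  -- at distance at most `ρ + 3 δ`. For `ρ < δ` this is less than the mesh `4 δ`; for `ρ ≥ δ` it is
  -- at most `4 ρ`.
  have key : ∀ j ∈ G, ∀ k ∈ G, ∀ i, 4 * δ * |(j i : ℝ) - k i| ≤ ρ + 3 * δ := by
    intro j hj k hk i
    obtain ⟨h1, y, hyV, hy⟩ := hG j hj
    obtain ⟨h2, z, hzV, hz⟩ := hG k hk
    set gj : Fin d → ℝ := x + (4 * δ) • fun i => (j i : ℝ) with hgj
    set gk : Fin d → ℝ := x + (4 * δ) • fun i => (k i : ℝ) with hgk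
    have h3 : dist gj gk ≤ ρ + 3 * δ := by
      have t1 := dist_triangle gj (c j) gk
      have t2 := dist_triangle (c j) y gk
      have t3 := dist_triangle y z gk
      have t4 := dist_triangle z (c k) gk
      have := hV y hyV z hzV
      rw [Metric.mem_closedBall] at hy hz
      rw [dist_comm] at hy
      rw [dist_comm (c j) gj] at h1
      linarith
    have h4 : dist (gj i) (gk i) = 4 * δ * |(j i : ℝ) - k i| := by
      rw [Real.dist_eq, ← abs_of_pos (show 0 < 4 * δ by positivity), ← abs_mul]
      congr 1
      simp [hgj, hgk]
      ring
    rw [← h4]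
    exact (dist_le_pi_dist gj gk i).trans h3
  constructor
  · intro hρ
    rw [Finset.card_le_one]
    intro j hj k hk
    ext i
    have h1 := key j hj k hk i
    have h2 : |(j i : ℝ) - k i| < 1 := by
      by_contra hcon
      nlinarith [not_lt.1 hcon]
    have h3 : |(j i : ℤ) - k i| < 1 := by exact_mod_cast h2
    rw [Int.abs_lt_one_iff] at h3
    omega
  · intro hρ
    rcases G.eq_empty_or_nonempty with rfl | ⟨k, hk⟩
    · have : 0 < ρ := hδ.trans_le hρ
      simp only [Finset.card_empty, CharP.cast_eq_zero]
      positivity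
    have hsub : G ⊆ Fintype.piFinset fun i => (G.image fun j => j i) := fun j hj =>
      Fintype.mem_piFinset.2 fun i => Finset.mem_image.2 ⟨j, hj, rfl⟩
    calc (G.card : ℝ) ≤ ∏ i, ((G.image fun j => j i).card : ℝ) := by
          have := Finset.card_le_card hsub
          rw [Fintype.card_piFinset] at this
          exact_mod_cast this
      _ ≤ ∏ _i : Fin d, (3 * ρ / δ) := by
          refine Finset.prod_le_prod (fun _ _ => by positivity) fun i _ => ?_
          have hρδ : 1 ≤ ρ / δ := by rwa [le_div_iff₀ hδ, one_mul]
          refine (card_nat_le_of_forall_mem_Icc (u := k i - ρ / δ) (v := k i + ρ / δ)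
            (by linarith) fun n hn => ?_).trans ?_
          · obtain ⟨j, hj, rfl⟩ := Finset.mem_image.1 hn
            have h1 : |(j i : ℝ) - k i| ≤ ρ / δ := by
              rw [le_div_iff₀ hδ]
              nlinarith [key j hj k hk i]
            rw [abs_le] at h1
            constructor <;> linarith
          · rw [mul_div_assoc]
            linarith
      _ = _ := by rw [Finset.prod_const, Finset.card_univ, Fintype.card_fin]

/-- Averaging over perturbed grid points: some small ball inherits the smallness of the weight. -/
theorem exists_meetSum_le {d : ℕ} {s κ : ℝ} (hs0 : 0 < s) (hsd : s ≤ d) (hκ0 : 0 < κ)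
    (hκ : 4 * 48 ^ d * κ ≤ 1)
    {U : ℕ → Set (Fin d → ℝ)} {ρ : ℕ → ℝ} (hρ : ∀ n, 0 < ρ n)
    (hU : ∀ n, ∀ y ∈ U n, ∀ z ∈ U n, dist y z ≤ ρ n)
    {x : Fin d → ℝ} {R : ℝ} (hR : 0 < R)
    (hP : meetSum U ρ s x R ≤ ENNReal.ofReal (κ * R ^ s)) {δ r : ℝ} (hδ : 0 < δ) (hr : 0 < r)
    {K : ℕ} {G : Finset (Fin d → ℕ)} (hK : R ≤ 16 * δ * K) (hG : (K : ℝ) ^ d / 2 ≤ G.card)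
    (hrK : R ^ s / r ^ s < (K : ℝ) ^ d / 4) {c : (Fin d → ℕ) → Fin d → ℝ}
    (hc : ∀ j ∈ G, dist (c j) (x + (4 * δ) • fun i => (j i : ℝ)) + r ≤ 3 / 2 * δ)
    (hcR : ∀ j ∈ G, Metric.closedBall (c j) r ⊆ Metric.closedBall x R) :
    ∃ j ∈ G, meetSum U ρ s (c j) r ≤ ENNReal.ofReal (κ * r ^ s) := by
  classical
  -- The costs are such that `Φ j < 1` gives the claim for `j`: no set of size at least `δ` can meet
  -- that ball, and the small ones weigh less than `κ * r ^ s` together.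
  set cost : ℕ → ℝ := fun n => if ρ n < δ then ρ n ^ s / (κ * r ^ s) else 1 with hcost
  have hcost0 : ∀ n, 0 ≤ cost n := fun n => by
    have := hρ n
    simp only [hcost]
    split_ifs <;> positivity
  set meets : ℕ → (Fin d → ℕ) → Prop := fun n j => (U n ∩ Metric.closedBall (c j) r).Nonempty
    with hmeets
  set Φ : (Fin d → ℕ) → ℝ≥0∞ := fun j => ∑' n, if meets n j then ENNReal.ofReal (cost n) else 0
    with hΦ
  set A : ℝ := 1 / (κ * r ^ s) + (3 / δ) ^ d * R ^ ((d : ℝ) - s) with hA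
  have hA0 : 0 ≤ A := by positivity
  have hκ1 : κ ≤ 1 := by
    have : (1 : ℝ) ≤ 48 ^ d := one_le_pow₀ (by norm_num)
    nlinarith
  have hterm : ∀ n, ∑ j ∈ G, (if meets n j then ENNReal.ofReal (cost n) else 0) ≤
      (if (U n ∩ Metric.closedBall x R).Nonempty then ENNReal.ofReal (ρ n ^ s) else 0) *
        ENNReal.ofReal A := by
    intro n
    have hρn := hρ n
    rw [← Finset.sum_filter, Finset.sum_const, nsmul_eq_mul]
    rcases (G.filter (meets n)).eq_empty_or_nonempty with h0 | ⟨j, hj⟩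
    · rw [h0]
      simp
    obtain ⟨hjG, hj⟩ := Finset.mem_filter.1 hj
    have hB : (U n ∩ Metric.closedBall x R).Nonempty :=
      hj.mono (inter_subset_inter_right _ (hcR j hjG))
    rw [if_pos hB, ← ENNReal.ofReal_natCast, ← ENNReal.ofReal_mul (by positivity),
      ← ENNReal.ofReal_mul (by positivity)]
    apply ENNReal.ofReal_le_ofReal
    obtain ⟨hsmall, hlarge⟩ := card_filter_grid_meet_le (x := x) hδ (hU n)
      (G := G.filter (meets n)) fun j hj =>
        ⟨hc j (Finset.mem_filter.1 hj).1, (Finset.mem_filter.1 hj).2⟩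
    rcases lt_or_ge (ρ n) δ with h | h
    · have h1 : ((G.filter (meets n)).card : ℝ) ≤ 1 := by exact_mod_cast hsmall h
      calc _ ≤ 1 * cost n := by
            gcongr
        _ = ρ n ^ s * (1 / (κ * r ^ s)) := by
            simp only [hcost, h, if_true]
            ring
        _ ≤ _ := by
            gcongr
            exact le_add_of_nonneg_right (by positivity)
    · have hρR : ρ n ≤ R := by
        have h1 := (ofReal_rpow_le_meetSum hB).trans hP
        rw [ENNReal.ofReal_le_ofReal_iff (by positivity)] at h1
        have h2 : ρ n ^ s ≤ R ^ s := h1.trans (mul_le_of_le_one_left (by positivity) hκ1)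
        exact (Real.rpow_le_rpow_iff hρn.le hR.le hs0).1 h2
      calc _ ≤ (3 * ρ n / δ) ^ d * 1 := by
            simp only [hcost, h.not_gt, if_false]
            gcongr
            exact hlarge h
        _ = (3 / δ) ^ d * (ρ n ^ s * ρ n ^ ((d : ℝ) - s)) := by
            rw [← Real.rpow_add hρn, add_sub_cancel, Real.rpow_natCast, mul_one, ← mul_pow]
            ring
        _ ≤ (3 / δ) ^ d * (ρ n ^ s * R ^ ((d : ℝ) - s)) := by
            gcongr
        _ = ρ n ^ s * ((3 / δ) ^ d * R ^ ((d : ℝ) - s)) := by ring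
        _ ≤ _ := by
            gcongr
            exact le_add_of_nonneg_left (by positivity)
  have hsum : ∑ j ∈ G, Φ j < G.card := by
    have hRA : κ * R ^ s * A < (K : ℝ) ^ d / 2 := by
      have e1 : κ * R ^ s * A = R ^ s / r ^ s + κ * (3 * R / δ) ^ d := by
        rw [hA, mul_add]
        congr 1
        · field_simp
        · have : R ^ d = R ^ s * R ^ ((d : ℝ) - s) := by
            rw [← Real.rpow_add hR, add_sub_cancel, Real.rpow_natCast]
          rw [mul_div_right_comm, mul_pow, this]
          ring
      -- Here `48 = 3 * 16`, from `R ≤ 16 * δ * K`; this fixes the smallness required of `κ`.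
      have e2 : κ * (3 * R / δ) ^ d ≤ (K : ℝ) ^ d / 4 := by
        calc κ * (3 * R / δ) ^ d ≤ κ * (48 * K) ^ d := by
              gcongr
              rw [div_le_iff₀ hδ]
              linarith
          _ = (4 * 48 ^ d * κ) * ((K : ℝ) ^ d / 4) := by
              rw [mul_pow]
              ring
          _ ≤ 1 * ((K : ℝ) ^ d / 4) := by gcongr
          _ = _ := one_mul _
      rw [e1]
      linarith
    calc ∑ j ∈ G, Φ j
        = ∑' n, ∑ j ∈ G, (if meets n j then ENNReal.ofReal (cost n) else 0) :=
          (Summable.tsum_finsetSum fun _ _ => ENNReal.summable).symm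
      _ ≤ ∑' n, (if (U n ∩ Metric.closedBall x R).Nonempty then ENNReal.ofReal (ρ n ^ s) else 0) *
            ENNReal.ofReal A := ENNReal.tsum_le_tsum hterm
      _ = meetSum U ρ s x R * ENNReal.ofReal A := ENNReal.tsum_mul_right
      _ ≤ ENNReal.ofReal (κ * R ^ s) * ENNReal.ofReal A := by gcongr
      _ = ENNReal.ofReal (κ * R ^ s * A) := (ENNReal.ofReal_mul (by positivity)).symm
      _ < ENNReal.ofReal G.card :=
          (ENNReal.ofReal_lt_ofReal_iff_of_nonneg (by positivity)).2 (hRA.trans_le hG)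
      _ = G.card := ENNReal.ofReal_natCast _
  obtain ⟨j, hjG, hj⟩ : ∃ j ∈ G, Φ j < 1 := by
    by_contra! hcon
    refine hsum.not_ge ?_
    calc (G.card : ℝ≥0∞) = ∑ j ∈ G, 1 := by simp
      _ ≤ _ := Finset.sum_le_sum hcon
  refine ⟨j, hjG, ?_⟩
  have hκr : 0 < κ * r ^ s := by positivity
  have hle : ∀ n, (if meets n j then ENNReal.ofReal (ρ n ^ s) else 0) ≤
      ENNReal.ofReal (κ * r ^ s) * if meets n j then ENNReal.ofReal (cost n) else 0 := by
    intro n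
    split_ifs with hm
    · have h1 : ENNReal.ofReal (cost n) ≤ Φ j := by
        refine le_trans ?_ (ENNReal.le_tsum n)
        rw [if_pos hm]
      have h2 : ρ n < δ := by
        by_contra hcon
        have := h1.trans_lt hj
        simp [hcost, hcon] at this
      rw [← ENNReal.ofReal_mul hκr.le]
      apply ENNReal.ofReal_le_ofReal
      simp only [hcost, h2, if_true]
      rw [mul_div_cancel₀ _ hκr.ne']
    · simp
  calc meetSum U ρ s (c j) r
      ≤ ∑' n, ENNReal.ofReal (κ * r ^ s) * if meets n j then ENNReal.ofReal (cost n) else 0 :=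
        ENNReal.tsum_le_tsum hle
    _ = ENNReal.ofReal (κ * r ^ s) * Φ j := ENNReal.tsum_mul_left
    _ ≤ ENNReal.ofReal (κ * r ^ s) * 1 := by gcongr
    _ = _ := mul_one _

/-! ### Nested balls and a point outside the cover -/

/-- One step of the construction of a point of `D(η)` avoiding a family of sets of small total
weight: inside a ball met only by sets of small weight there is a smaller such ball all of whose
points have a normalized approximation near a prescribed point. -/
theorem exists_closedBall_approx {d : ℕ} (hd : 1 ≤ d) {η s κ : ℝ} (hη : 1 / (d : ℝ) < η)
    (hs0 : 0 < s) (hs : (1 + η) * s < d + 1) (hκ0 : 0 < κ) (hκ : 4 * 48 ^ d * κ ≤ 1)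
    {U : ℕ → Set (Fin d → ℝ)} {ρ : ℕ → ℝ} (hρ : ∀ n, 0 < ρ n)
    (hU : ∀ n, ∀ y ∈ U n, ∀ z ∈ U n, dist y z ≤ ρ n)
    {x : Fin d → ℝ} {R : ℝ} (hR : 0 < R)
    (hP : meetSum U ρ s x R ≤ ENNReal.ofReal (κ * R ^ s)) (y : Fin d → ℝ) {e : ℝ} (he : 0 < e) :
    ∃ (x' : Fin d → ℝ) (r : ℝ), 0 < r ∧ r ≤ R / 2 ∧
      meetSum U ρ s x' r ≤ ENNReal.ofReal (κ * r ^ s) ∧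
      Metric.closedBall x' r ⊆ Metric.closedBall x R ∧
      ∀ z ∈ Metric.closedBall x' r, ∃ v ∈ normalizedApprox η z, dist v y ≤ e := by
  have hd0 : (0 : ℝ) < d := by exact_mod_cast hd
  have hdη : 1 < η * d := by rwa [div_lt_iff₀ hd0] at hη
  have hη0 : 0 < η := lt_trans (by positivity) hη
  have hsd : s ≤ d := by nlinarith
  obtain ⟨A, hA, hgrid⟩ := exists_grid_near_rational hd
  have hA0 : (0 : ℝ) < A := by exact_mod_cast hA
  set D : ℝ := d * (1 + η) with hD
  -- The exponent is `d * η - 1 > 0`; this makes shift plus radius at most `δ / 2`.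
  have ev1 : ∀ᶠ M : ℕ in atTop,
      2 * ((A : ℝ) ^ (1 + η) * ‖y‖ + e) / A ≤ (M : ℝ) ^ (D - (d + 1)) :=
    ((tendsto_rpow_atTop (by rw [hD]; linarith)).comp
      tendsto_natCast_atTop_atTop).eventually_ge_atTop _
  -- The exponent is `d * (d + 1 - (1 + η) * s) > 0`; this makes the grid points outnumber `4 * (R /
  -- r) ^ s`.
  have ev2 : ∀ᶠ M : ℕ in atTop,
      4 * (R ^ s / e ^ s) * (16 * A / R) ^ d < (M : ℝ) ^ (d * (d + 1) - D * s) :=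
    ((tendsto_rpow_atTop (by rw [hD]; nlinarith)).comp
      tendsto_natCast_atTop_atTop).eventually_gt_atTop _
  obtain ⟨M, hM1, hM2, hM3, hM4⟩ :=
    (ev1.and (ev2.and ((hgrid x hR).and (eventually_ge_atTop 1)))).exists
  have hM0 : (0 : ℝ) < M := by exact_mod_cast hM4
  set δ : ℝ := A / (M : ℝ) ^ (d + 1) with hδ
  have hδ0 : 0 < δ := by positivity
  obtain ⟨K, G, hKR, hKR', hGJ, hGc, hq⟩ := hM3 δ rfl
  choose! q p hq0 hqM hqM' hqp using hq
  -- Multiplying by `q ^ (1 + η) ≤ M ^ D` enlarges a ball of radius `r` to one of radius at most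
  -- `e`.
  set r : ℝ := e * (M : ℝ) ^ (-D) with hr
  have hr0 : 0 < r := by positivity
  have hK1 : (1 : ℝ) ≤ K := by
    have : (K : ℝ) ≠ 0 := by
      intro h
      rw [h] at hKR
      linarith
    have : 1 ≤ K := Nat.one_le_iff_ne_zero.2 (by exact_mod_cast this)
    exact_mod_cast this
  have hδR : 8 * δ ≤ R := le_trans (by nlinarith) hKR'
  have hshift : (A : ℝ) ^ (1 + η) * (M : ℝ) ^ (-D) * ‖y‖ + r ≤ δ / 2 := by
    have h1 : (M : ℝ) ^ (D - (d + 1)) * (M : ℝ) ^ (-D) = 1 / (M : ℝ) ^ (d + 1) := by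
      rw [← Real.rpow_add hM0, show D - (d + 1) + -D = -((d + 1 : ℕ) : ℝ) by push_cast; ring,
        Real.rpow_neg hM0.le, Real.rpow_natCast, one_div]
    rw [div_le_iff₀ hA0] at hM1
    calc _ = ((A : ℝ) ^ (1 + η) * ‖y‖ + e) * (M : ℝ) ^ (-D) := by rw [hr]; ring
      _ ≤ ((M : ℝ) ^ (D - (d + 1)) * A / 2) * (M : ℝ) ^ (-D) := by
        gcongr
        linarith
      _ = A / 2 * ((M : ℝ) ^ (D - (d + 1)) * (M : ℝ) ^ (-D)) := by ring
      _ = δ / 2 := by rw [h1, hδ]; ring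
  have hrδ : r ≤ δ / 2 := by
    have : 0 ≤ (A : ℝ) ^ (1 + η) * (M : ℝ) ^ (-D) * ‖y‖ := by positivity
    linarith
  have hrK : R ^ s / r ^ s < (K : ℝ) ^ d / 4 := by
    have h1 : (M : ℝ) ^ (d * (d + 1) - D * s) * (M : ℝ) ^ (D * s) = ((M : ℝ) ^ (d + 1)) ^ d := by
      rw [← Real.rpow_add hM0, sub_add_cancel, ← pow_mul, ← Real.rpow_natCast]
      push_cast
      ring_nf
    have h2 : R ^ s / r ^ s = R ^ s / e ^ s * (M : ℝ) ^ (D * s) := by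
      rw [hr, Real.mul_rpow he.le (by positivity), ← Real.rpow_mul hM0.le, neg_mul,
        Real.rpow_neg hM0.le]
      field_simp
    have h3 : (R / (16 * δ)) ^ d ≤ (K : ℝ) ^ d := by
      gcongr
      rw [div_le_iff₀ (by positivity)]
      linarith
    have h4 : (16 * A / R) ^ d * (R / (16 * δ)) ^ d = ((M : ℝ) ^ (d + 1)) ^ d := by
      rw [← mul_pow, hδ]
      congr 1
      field_simp
    have h5 : 4 * (R ^ s / e ^ s) * (16 * A / R) ^ d * (M : ℝ) ^ (D * s) <
        (16 * A / R) ^ d * (R / (16 * δ)) ^ d := by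
      rw [h4, ← h1]
      gcongr
    have h6 : 4 * (R ^ s / e ^ s * (M : ℝ) ^ (D * s)) < (R / (16 * δ)) ^ d := by
      refine lt_of_mul_lt_mul_left ?_ (show 0 ≤ (16 * A / R) ^ d by positivity)
      linarith
    rw [h2]
    linarith
  -- The centre is the point whose normalized approximation by `p j / q j` is exactly `y`.
  set c : (Fin d → ℕ) → Fin d → ℝ := fun j =>
    (q j : ℝ)⁻¹ • (fun i => (p j i : ℝ)) + (q j : ℝ) ^ (-(1 + η)) • y with hc
  have hcdist : ∀ j ∈ G, dist (c j) (x + (4 * δ) • fun i => (j i : ℝ)) + r ≤ 3 / 2 * δ := by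
    intro j hj
    have hqj : (0 : ℝ) < q j := by exact_mod_cast hq0 j hj
    have h1 : ‖(q j : ℝ)⁻¹ • (fun i => (p j i : ℝ)) - (x + (4 * δ) • fun i => (j i : ℝ))‖ ≤ δ := by
      rw [pi_norm_le_iff_of_nonneg hδ0.le]
      intro i
      have e1 : ((q j : ℝ)⁻¹ • (fun i => (p j i : ℝ)) -
          (x + (4 * δ) • fun i => (j i : ℝ))) i =
          -((q j : ℝ)⁻¹ * (q j * (x i + 4 * δ * j i) - p j i)) := by
        simp only [Pi.sub_apply, Pi.add_apply, Pi.smul_apply, smul_eq_mul]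
        field_simp
        ring
      rw [e1, norm_neg, norm_mul, norm_inv, Real.norm_of_nonneg hqj.le, Real.norm_eq_abs]
      calc _ ≤ (q j : ℝ)⁻¹ * (1 / M) := by
            gcongr
            exact hqp j hj i
        _ ≤ (A / (M : ℝ) ^ d) * (1 / M) := by
            gcongr
            rw [inv_eq_one_div, div_le_div_iff₀ hqj (by positivity), one_mul]
            exact hqM j hj
        _ = δ := by
            rw [hδ, pow_succ]
            field_simp
    have h2 : (q j : ℝ) ^ (-(1 + η)) ≤ (A : ℝ) ^ (1 + η) * (M : ℝ) ^ (-D) := by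
      calc (q j : ℝ) ^ (-(1 + η)) ≤ ((M : ℝ) ^ d / A) ^ (-(1 + η)) := by
            refine Real.rpow_le_rpow_of_nonpos (by positivity) ?_ (by linarith)
            rw [div_le_iff₀ hA0]
            linarith [hqM j hj]
        _ = _ := by
            rw [Real.div_rpow (by positivity) hA0.le, ← Real.rpow_natCast, ← Real.rpow_mul hM0.le,
              Real.rpow_neg hA0.le, div_inv_eq_mul, mul_comm, hD, mul_neg]
    rw [dist_eq_norm, hc]
    have h3 : ‖(q j : ℝ) ^ (-(1 + η)) • y‖ ≤ (A : ℝ) ^ (1 + η) * (M : ℝ) ^ (-D) * ‖y‖ := by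
      rw [norm_smul, Real.norm_of_nonneg (by positivity)]
      gcongr
    simp only
    rw [add_sub_right_comm]
    linarith [norm_add_le ((q j : ℝ)⁻¹ • (fun i => (p j i : ℝ)) -
      (x + (4 * δ) • fun i => (j i : ℝ))) ((q j : ℝ) ^ (-(1 + η)) • y)]
  have hcball : ∀ j ∈ G, Metric.closedBall (c j) r ⊆ Metric.closedBall x R := by
    intro j hj
    apply Metric.closedBall_subset_closedBall'
    have h1 : dist (x + (4 * δ) • fun i => (j i : ℝ)) x ≤ 4 * δ * K := by
      rw [dist_eq_norm, add_sub_cancel_left, norm_smul, Real.norm_of_nonneg (by positivity)]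
      gcongr
      rw [pi_norm_le_iff_of_nonneg (by positivity)]
      intro i
      rw [Real.norm_of_nonneg (by positivity)]
      exact_mod_cast (Finset.mem_range.1 (Fintype.mem_piFinset.1 (hGJ hj) i)).le
    have h2 := dist_triangle (c j) (x + (4 * δ) • fun i => (j i : ℝ)) x
    have h3 := hcdist j hj
    linarith
  obtain ⟨j, hj, hPj⟩ := exists_meetSum_le hs0 hsd hκ0 hκ hρ hU hR hP hδ0 hr0 hKR hGc hrK
    hcdist hcball
  refine ⟨c j, r, hr0, by linarith, hPj, hcball j hj, fun z hz => ?_⟩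
  have hqj : (0 : ℝ) < q j := by exact_mod_cast hq0 j hj
  refine ⟨_, ⟨q j, p j, by exact_mod_cast (hq0 j hj).ne', rfl⟩, ?_⟩
  have e1 : (|(((q j : ℕ) : ℤ) : ℝ)| ^ η) • ((((q j : ℕ) : ℤ) : ℝ) • z - fun i => (p j i : ℝ)) - y =
      (q j : ℝ) ^ (1 + η) • (z - c j) := by
    have e2 : (q j : ℝ) ^ (1 + η) * (q j : ℝ) ^ (-(1 + η)) = 1 := by
      rw [← Real.rpow_add hqj, add_neg_cancel, Real.rpow_zero]
    have e3 : (q j : ℝ) ^ (1 + η) = (q j : ℝ) ^ η * q j := by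
      rw [add_comm, Real.rpow_add hqj, Real.rpow_one]
    simp only [hc]
    rw [smul_sub _ z, smul_add, smul_smul _ _ y, e2, one_smul, e3, Int.cast_natCast,
      abs_of_pos hqj, smul_sub, smul_smul, smul_smul, mul_assoc, mul_inv_cancel₀ hqj.ne', mul_one]
    abel
  rw [Metric.mem_closedBall, dist_eq_norm] at hz
  rw [dist_eq_norm, e1, norm_smul, Real.norm_of_nonneg (by positivity)]
  calc (q j : ℝ) ^ (1 + η) * ‖z - c j‖ ≤ ((M : ℝ) ^ d) ^ (1 + η) * r := by
        gcongr
        exact_mod_cast hqM' j hj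
    _ = e := by
        rw [hr, ← Real.rpow_natCast, ← Real.rpow_mul hM0.le, ← hD, mul_left_comm,
          ← Real.rpow_add hM0, add_neg_cancel, Real.rpow_zero, mul_one]

theorem mem_denseSet_of_dense {d : ℕ} (hd : 1 ≤ d) {η : ℝ} {α : Fin d → ℝ}
    (h : Dense (normalizedApprox η α)) : α ∈ denseSet d η := by
  -- Nonemptiness excludes `ℝ ^ 0`; without isolated points, a dense set stays dense after removal
  -- of one point.
  have : Nonempty (Fin d) := ⟨⟨0, hd⟩⟩
  refine eq_univ_of_forall fun x => ?_
  change AccPt x (𝓟 (normalizedApprox η α))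
  rw [accPt_iff_nhds]
  intro V hV
  obtain ⟨y, hyV, hy⟩ := ((h.sdiff_singleton x).inter_nhds_nonempty hV)
  exact ⟨y, ⟨hy, hyV.1⟩, hyV.2⟩

/-- A family of sets of small total weight does not cover `D(η)`. -/
theorem not_denseSet_subset_iUnion {d : ℕ} (hd : 1 ≤ d) {η s κ : ℝ} (hη : 1 / (d : ℝ) < η)
    (hs0 : 0 < s) (hs : (1 + η) * s < d + 1) (hκ0 : 0 < κ) (hκ : 4 * 48 ^ d * κ ≤ 1)
    {U : ℕ → Set (Fin d → ℝ)} {ρ : ℕ → ℝ} (hρ : ∀ n, 0 < ρ n)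
    (hU : ∀ n, ∀ y ∈ U n, ∀ z ∈ U n, dist y z ≤ ρ n)
    (hsum : ∑' n, ENNReal.ofReal (ρ n ^ s) ≤ ENNReal.ofReal κ) :
    ¬ denseSet d η ⊆ ⋃ n, U n := by
  intro hcover
  let B := {b : (Fin d → ℝ) × ℝ // 0 < b.2 ∧ meetSum U ρ s b.1 b.2 ≤ ENNReal.ofReal (κ * b.2 ^ s)}
  -- Unpairing `k` runs through all pairs of a dense-sequence point and an error `1 / (n + 1)`.
  let target : ℕ → Fin d → ℝ := fun k => TopologicalSpace.denseSeq (Fin d → ℝ) k.unpair.1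
  let err : ℕ → ℝ := fun k => 1 / ((k.unpair.2 : ℝ) + 1)
  have step : ∀ (k : ℕ) (b : B), ∃ b' : B, b'.1.2 ≤ b.1.2 / 2 ∧
      Metric.closedBall b'.1.1 b'.1.2 ⊆ Metric.closedBall b.1.1 b.1.2 ∧
      ∀ z ∈ Metric.closedBall b'.1.1 b'.1.2,
        ∃ v ∈ normalizedApprox η z, dist v (target k) ≤ err k := by
    rintro k ⟨⟨x, R⟩, hR, hP⟩
    obtain ⟨x', r, hr, hrR, hP', hsub, happ⟩ := exists_closedBall_approx hd hη hs0 hs hκ0 hκ hρ hU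
      hR hP (target k) (e := err k) Nat.one_div_pos_of_nat
    exact ⟨⟨(x', r), hr, hP'⟩, hrR, hsub, happ⟩
  choose next hnext1 hnext2 hnext3 using step
  have hstart : meetSum U ρ s 0 1 ≤ ENNReal.ofReal (κ * (1 : ℝ) ^ s) := by
    classical
    rw [Real.one_rpow, mul_one]
    refine le_trans (ENNReal.tsum_le_tsum fun n => ?_) hsum
    split_ifs <;> simp
  obtain ⟨b, hb0, hb⟩ : ∃ b : ℕ → B, (b 0).1.2 = 1 ∧ ∀ k, b (k + 1) = next k (b k) :=
    ⟨fun k => Nat.rec ⟨(0, 1), one_pos, hstart⟩ (fun k b => next k b) k, rfl, fun _ => rfl⟩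
  obtain ⟨z, hz⟩ := IsCompact.nonempty_iInter_of_sequence_nonempty_isCompact_isClosed
    (fun k => Metric.closedBall (b k).1.1 (b k).1.2)
    (fun k => by simpa only [hb] using hnext2 k (b k))
    (fun k => Metric.nonempty_closedBall.2 (b k).2.1.le) (isCompact_closedBall _ _)
    fun k => Metric.isClosed_closedBall
  rw [mem_iInter] at hz
  have hrad : ∀ k, (b k).1.2 ≤ (1 / 2) ^ k := by
    intro k
    induction k with
    | zero => simp [hb0]
    | succ k ih =>
      rw [hb, pow_succ]
      linarith [hnext1 k (b k)]
  have hzD : z ∈ denseSet d η := by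
    refine mem_denseSet_of_dense hd (Metric.dense_iff.2 fun y ε hε => ?_)
    obtain ⟨_, hv, a, rfl⟩ := Metric.dense_iff.1
      (TopologicalSpace.denseRange_denseSeq (Fin d → ℝ)) y (ε / 2) (by positivity)
    obtain ⟨n, hn⟩ := exists_nat_one_div_lt (show 0 < ε / 2 by positivity)
    obtain ⟨v, hv1, hv2⟩ := hnext3 (Nat.pair a n) (b (Nat.pair a n)) z
      (by simpa only [hb] using hz (Nat.pair a n + 1))
    refine ⟨v, ?_, hv1⟩
    simp only [target, err, Nat.unpair_pair] at hv2
    rw [Metric.mem_ball] at hv ⊢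
    linarith [dist_triangle v (TopologicalSpace.denseSeq (Fin d → ℝ) a) y]
  obtain ⟨n, hn⟩ := mem_iUnion.1 (hcover hzD)
  have hle : ∀ k, ρ n ^ s ≤ κ * ((1 / 2 : ℝ) ^ k) ^ s := by
    intro k
    have h1 := (ofReal_rpow_le_meetSum (ρ := ρ) (s := s) ⟨z, hn, hz k⟩).trans (b k).2.2
    have hpos := (b k).2.1
    rw [ENNReal.ofReal_le_ofReal_iff (by positivity)] at h1
    refine h1.trans ?_
    gcongr
    exact hrad k
  have hlim : Tendsto (fun k : ℕ => κ * ((1 / 2 : ℝ) ^ k) ^ s) atTop (𝓝 0) := by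
    have h1 := tendsto_pow_atTop_nhds_zero_of_lt_one (r := (1 / 2 : ℝ)) (by norm_num) (by norm_num)
    have h2 := (h1.rpow_const (p := s) (Or.inr hs0.le)).const_mul κ
    rwa [Real.zero_rpow hs0.ne', mul_zero] at h2
  exact (Real.rpow_pos_of_pos (hρ n) s).not_ge (ge_of_tendsto' hlim hle)

/-! ### Covers of null sets and the dimension formula -/

/-- A set of zero Hausdorff measure has countable covers of arbitrarily small total weight. -/
theorem exists_cover_of_hausdorffMeasure_eq_zero {X : Type*} [MetricSpace X]
    [MeasurableSpace X] [BorelSpace X] {s : ℝ} (hs : 0 < s) {E : Set X} (hE : μH[s] E = 0)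
    {κ : ℝ} (hκ : 0 < κ) :
    ∃ (U : ℕ → Set X) (ρ : ℕ → ℝ), (∀ n, 0 < ρ n) ∧ (∀ n, ∀ y ∈ U n, ∀ z ∈ U n, dist y z ≤ ρ n) ∧
      ∑' n, ENNReal.ofReal (ρ n ^ s) ≤ ENNReal.ofReal κ ∧ E ⊆ ⋃ n, U n := by
  rw [hausdorffMeasure_apply] at hE
  have h1 := (ENNReal.iSup_eq_zero.1 (ENNReal.iSup_eq_zero.1 hE 1)) one_pos
  have hκ' : (0 : ℝ≥0∞) < ENNReal.ofReal (κ / 2) := by simpa using hκ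
  have h2 := h1.trans_lt hκ'
  simp only [iInf_lt_iff] at h2
  obtain ⟨U, hcov, -, hsum⟩ := h2
  obtain ⟨τ, hτ0, hτ⟩ := ENNReal.exists_pos_sum_of_countable' hκ'.ne' ℕ
  -- Adding the summable `τ n` makes every size positive, even for empty sets and single points.
  set w : ℕ → ℝ≥0∞ := fun n => (⨆ _ : (U n).Nonempty, Metric.ediam (U n) ^ s) + τ n with hw
  have hwsum : ∑' n, w n ≤ ENNReal.ofReal κ := by
    rw [hw, ENNReal.tsum_add, ← add_halves κ, ENNReal.ofReal_add (by positivity) (by positivity)]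
    exact add_le_add hsum.le hτ.le
  have hwtop : ∀ n, w n ≠ ∞ := fun n =>
    ne_top_of_le_ne_top ENNReal.ofReal_ne_top ((ENNReal.le_tsum n).trans hwsum)
  have hw0 : ∀ n, 0 < (w n).toReal := fun n =>
    ENNReal.toReal_pos (lt_of_lt_of_le (hτ0 n) le_add_self).ne' (hwtop n)
  have hpow : ∀ n, ((w n).toReal ^ s⁻¹) ^ s = (w n).toReal := fun n =>
    Real.rpow_inv_rpow (hw0 n).le hs.ne'
  refine ⟨U, fun n => (w n).toReal ^ s⁻¹, fun n => Real.rpow_pos_of_pos (hw0 n) _, ?_, ?_, hcov⟩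
  · intro n y hy z hz
    have h3 : edist y z ^ s ≤ w n := by
      calc edist y z ^ s ≤ Metric.ediam (U n) ^ s := by
            gcongr
            exact Metric.edist_le_ediam_of_mem hy hz
        _ ≤ ⨆ _ : (U n).Nonempty, Metric.ediam (U n) ^ s :=
            le_iSup (fun _ : (U n).Nonempty => Metric.ediam (U n) ^ s) ⟨y, hy⟩
        _ ≤ w n := le_self_add
    rw [← ENNReal.le_rpow_inv_iff hs] at h3
    simp only [dist_edist, ENNReal.toReal_rpow]
    exact ENNReal.toReal_mono (ENNReal.rpow_ne_top_of_nonneg (by positivity) (hwtop n)) h3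
  · simp only [hpow, ENNReal.ofReal_toReal (hwtop _)]
    exact hwsum

theorem le_dimH_denseSet {d : ℕ} (hd : 1 ≤ d) {η : ℝ} (hη : 1 / (d : ℝ) < η) :
    ENNReal.ofReal (((d : ℝ) + 1) / (1 + η)) ≤ dimH (denseSet d η) := by
  have hη0 : 0 < η := lt_of_le_of_lt (by positivity) hη
  refine le_of_forall_lt fun b hb => ?_
  obtain ⟨c, hc1, hc2⟩ := ENNReal.lt_iff_exists_nnreal_btwn.1 hb
  refine lt_of_lt_of_le hc1 (le_dimH_of_hausdorffMeasure_ne_zero fun h0 => ?_)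
  have hc0 : (0 : ℝ) < c := by
    have : (0 : ℝ≥0∞) < c := bot_le.trans_lt hc1
    exact_mod_cast this
  have hcs : (1 + η) * c < d + 1 := by
    rw [ENNReal.lt_ofReal_iff_toReal_lt ENNReal.coe_ne_top, ENNReal.coe_toReal,
      lt_div_iff₀ (by linarith)] at hc2
    linarith
  have hκ0 : (0 : ℝ) < 1 / (4 * 48 ^ d) := by positivity
  obtain ⟨U, ρ, hρ, hU, hsum, hcov⟩ := exists_cover_of_hausdorffMeasure_eq_zero hc0 h0 hκ0
  exact not_denseSet_subset_iUnion hd hη hc0 hcs hκ0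
    (mul_one_div_cancel (by positivity)).le hρ hU hsum hcov

theorem theorem3 (d : ℕ) (hd : 1 ≤ d) (η : ℝ) (hη : 1 / (d : ℝ) < η) :
    dimH (denseSet d η) = ENNReal.ofReal (((d : ℝ) + 1) / (1 + η)) := by
  exact le_antisymm (dimH_denseSet_le (lt_of_le_of_lt (by positivity) hη)) (le_dimH_denseSet hd hη)
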